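/- All topological spaces are regular $T_1$-spaces. For spaces $X,Y$ let $C_k(X,Y)$ be the set of all continuous functions $X\to Y$ with the compact-open topology. A class $\mathcal X$ of topological spaces is called $C_k$-stable if it is closed under taking subspaces, homeomorphic images, countable (possibly finite or empty) topological sums and countable (possibly finite or empty) Tychonoff products, and if $C_k(X,Y)\in\mathcal X$ for every Lindelöf space $X\in\mathcal X$ and every space $Y\in\mathcal X$. The $C_k$-stable closure of a class $\mathcal X$ is the smallest $C_k$-stable class containing $\mathcal X$. Let $C_k[\mathcal M_0]$ and $C_k[\mathcal M]$ be the $C_k$-stable closures of the class $\mathcal M_0$ of all separable metrizable spaces and of the class $\mathcal M$ of all metrizable spaces, respectively. A family $\mathcal N$ of subsets of a space $X$ is a $cp$-network if for every point $x\in X$, every neighborhood $O_x$ of $x$ and every set $A\subseteq X$ with $x\in\overline{A}$ there is $N\in\mathcal N$ such that $x\in N\subseteq O_x$ and, moreover, $N\cap A$ is infinite if $A$ accumulates at $x$ (that is, if $x\in\overline{A\setminus\{x\}}$). A $\mathfrak P_0$-space is a regular $T_1$-space with a countable $cp$-network, and a $\mathfrak P$-space is a regular $T_1$-space with a $\sigma$-locally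 finite $cp$-network (a union of countably many locally finite families). Then every space in $C_k[\mathcal M_0]$ is a $\mathfrak P_0$-space, and every space in $C_k[\mathcal M]$ is a paracompact $\mathfrak P$-space. -/

import Mathlib

open Set Filter Topology

universe u

/-- A class of topological spaces (living in the universe `Type u`). -/
abbrev SpaceClass : Type (u + 1) :=
  (X : Type u) → [TopologicalSpace X] → Prop

/-- A class of topological spaces is *stable* if it is closed under taking subspaces, homeomorphic
images, countable topological sums and countable Tychonoff products.
Countable index sets may be finite or empty. -/
structure SpaceClass.IsStable (𝒳 : SpaceClass.{u}) : Prop where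
  subspace : ∀ (X : Type u) [TopologicalSpace X] (s : Set X), 𝒳 X → 𝒳 s
  homeomorph : ∀ (X Y : Type u) [TopologicalSpace X] [TopologicalSpace Y],
    (X ≃ₜ Y) → 𝒳 X → 𝒳 Y
  sum : ∀ (ι : Type) [Countable ι] (X : ι → Type u) [∀ i, TopologicalSpace (X i)],
    (∀ i, 𝒳 (X i)) → 𝒳 (Σ i, X i)
  prod : ∀ (ι : Type) [Countable ι] (X : ι → Type u) [∀ i, TopologicalSpace (X i)],
    (∀ i, 𝒳 (X i)) → 𝒳 (∀ i, X i)

/-- A class of topological spaces is *`C_k`-stable* if it is stable and contains the space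
`C(X, Y)` of continuous functions with the compact-open topology, for every Lindelöf space `X`
and every space `Y` in the class. -/
structure SpaceClass.IsCkStable (𝒳 : SpaceClass.{u}) : Prop extends 𝒳.IsStable where
  functionSpace : ∀ (X Y : Type u) [TopologicalSpace X] [TopologicalSpace Y],
    LindelofSpace X → 𝒳 X → 𝒳 Y → 𝒳 C(X, Y)

/-- The class `𝒴` is an *extension* of the class `𝒳`. -/
def SpaceClass.IsExtension (𝒳 𝒴 : SpaceClass.{u}) : Prop :=
  ∀ (X : Type u) [TopologicalSpace X], 𝒳 X → 𝒴 X

/-- The *`C_k`-stable closure* of a class `𝒳`: the intersection of all `C_k`-stable extensions of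
`𝒳`, that is, the smallest `C_k`-stable extension of `𝒳` (see the two theorems below). -/
def SpaceClass.ckClosure (𝒳 : SpaceClass.{u}) : SpaceClass.{u} :=
  fun Z _ => ∀ 𝒴 : SpaceClass.{u}, 𝒴.IsCkStable → 𝒳.IsExtension 𝒴 → 𝒴 Z

theorem SpaceClass.isExtension_ckClosure (𝒳 : SpaceClass.{u}) :
    𝒳.IsExtension 𝒳.ckClosure :=
  fun X _ hX _ _ h => h X hX

theorem SpaceClass.isCkStable_ckClosure (𝒳 : SpaceClass.{u}) : 𝒳.ckClosure.IsCkStable where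
  subspace X _ s hX 𝒴 h𝒴 h := h𝒴.subspace X s (hX 𝒴 h𝒴 h)
  homeomorph X Y _ _ e hX 𝒴 h𝒴 h := h𝒴.homeomorph X Y e (hX 𝒴 h𝒴 h)
  sum ι _ X _ hX 𝒴 h𝒴 h := h𝒴.sum ι X fun i => hX i 𝒴 h𝒴 h
  prod ι _ X _ hX 𝒴 h𝒴 h := h𝒴.prod ι X fun i => hX i 𝒴 h𝒴 h
  functionSpace X Y _ _ hL hX hY 𝒴 h𝒴 h :=
    h𝒴.functionSpace X Y hL (hX 𝒴 h𝒴 h) (hY 𝒴 h𝒴 h)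

/-- The class of all metrizable spaces. -/
def metrizableClass : SpaceClass.{u} :=
  fun X _ => TopologicalSpace.MetrizableSpace X

/-- The class of all separable metrizable spaces. -/
def separableMetrizableClass : SpaceClass.{u} :=
  fun X _ => TopologicalSpace.SeparableSpace X ∧ TopologicalSpace.MetrizableSpace X

/-- A family `𝒩` of subsets of `X` is a *`cp`-network* if for every point `x`, every neighborhood
`O` of `x` and every set `A` with `x` in its closure there is `N ∈ 𝒩` with `x ∈ N ⊆ O`, and
moreover `N ∩ A` is infinite if `A` accumulates at `x`. -/
def IsCpNetwork {X : Type u} [TopologicalSpace X] (𝒩 : Set (Set X)) : Prop :=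
  ∀ (x : X), ∀ O ∈ 𝓝 x, ∀ A : Set X, x ∈ closure A →
    ∃ N ∈ 𝒩, x ∈ N ∧ N ⊆ O ∧ (AccPt x (𝓟 A) → (N ∩ A).Infinite)

/-- A family of subsets of `X` is *`σ`-locally finite* if it is the union of countably many
locally finite families. -/
def IsSigmaLocallyFinite {X : Type u} [TopologicalSpace X] (𝒩 : Set (Set X)) : Prop :=
  ∃ 𝒟 : ℕ → Set (Set X), 𝒩 = ⋃ n, 𝒟 n ∧
    ∀ n, LocallyFinite (fun N : 𝒟 n => (N : Set X))

/-- A *`𝔓₀`-space*: a regular `T₁` space with a countable `cp`-network. -/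
structure IsFrakP0Space (X : Type u) [TopologicalSpace X] : Prop where
  regular : T3Space X
  network : ∃ 𝒩 : Set (Set X), 𝒩.Countable ∧ IsCpNetwork 𝒩

/-- A *`𝔓`-space*: a regular `T₁` space with a `σ`-locally finite `cp`-network. -/
structure IsFrakPSpace (X : Type u) [TopologicalSpace X] : Prop where
  regular : T3Space X
  network : ∃ 𝒩 : Set (Set X), IsSigmaLocallyFinite 𝒩 ∧ IsCpNetwork 𝒩

/-! Every space in either closure embeds in a space of maps `X → Y` with the compact-open topology,
where `X` is Hausdorff with a countable `k`-network and `Y` is metrizable, and second-countable in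
the separable case. These spaces form `kClass`. The maps need only be continuous on compact sets:
uncurrying a continuous `Z → C(X, Y)` gives a function on `Z × X` for which no more than that is
guaranteed.

`kClass` is `C_k`-stable. Products and sums are represented over topological sums, and `C(Z, E)`
over `Z × X`. The last case needs a countable `k`-network on the Lindelöf space `Z`: its `σ`-locally
finite `cp`-network is countable, and finite unions of members of a countable `cp`-network form a
`k`-network.

Write `[N; B]` for the maps sending `N` into `B`. The `cp`-network consists of finite intersections
of sets `[N; B]`, with `N` in the `k`-network and `B` in a `σ`-locally finite base of `Y`
(`IsKRep.isCpNetwork`). If sets `N m` decrease to a compact `K`, then `[N m; B]` increases to `[K;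
B]`. If all of these met `A` in finite sets, the elements of `A` in `[K; B]` but outside an early
stage would be witnessed by points converging to `K`. These points and `K` form a compact set, which
defines a neighborhood of `f` excluding those elements, so `A` could not accumulate at `f`.
Evaluation at a point of `N` encloses `[N; B]` in an open set, which yields `σ`-local finiteness
and, by Michael's theorem, paracompactness. -/

/-! ### Michael's criterion for paracompactness. -/

/-- Every open cover has a locally finite refinement (by arbitrary sets). -/
def HasLocallyFiniteRefinements (X : Type u) [TopologicalSpace X] : Prop :=
  ∀ (α : Type u) (s : α → Set X), (∀ a, IsOpen (s a)) → ⋃ a, s a = univ →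
    ∃ (β : Type u) (t : β → Set X), ⋃ b, t b = univ ∧ LocallyFinite t ∧ ∀ b, ∃ a, t b ⊆ s a

/-- Regularity shrinks the cover to open sets whose closures still refine it, and taking closures
preserves local finiteness. -/
theorem HasLocallyFiniteRefinements.exists_closed {X : Type u} [TopologicalSpace X]
    [RegularSpace X] (h : HasLocallyFiniteRefinements X) (α : Type u) (s : α → Set X)
    (ho : ∀ a, IsOpen (s a)) (hc : ⋃ a, s a = univ) :
    ∃ (β : Type u) (t : β → Set X), (∀ b, IsClosed (t b)) ∧ ⋃ b, t b = univ ∧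
      LocallyFinite t ∧ ∀ b, ∃ a, t b ⊆ s a := by
  have h1 : ∀ x : X, ∃ a, x ∈ s a := fun x => by
    simpa using (hc ▸ mem_univ x : x ∈ ⋃ a, s a)
  choose a ha using h1
  have h2 : ∀ x, ∃ V, IsOpen V ∧ x ∈ V ∧ closure V ⊆ s (a x) := fun x => by
    obtain ⟨C, hC, hCc, hCs⟩ := exists_mem_nhds_isClosed_subset ((ho (a x)).mem_nhds (ha x))
    exact ⟨interior C, isOpen_interior, mem_interior_iff_mem_nhds.2 hC,
      (closure_minimal interior_subset hCc).trans hCs⟩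
  choose V hVo hxV hV using h2
  obtain ⟨β, t, htc, htl, hts⟩ := h X V hVo (iUnion_eq_univ_iff.2 fun x => ⟨x, hxV x⟩)
  refine ⟨β, fun b => closure (t b), fun _ => isClosed_closure, ?_, htl.closure, fun b => ?_⟩
  · exact eq_univ_of_univ_subset (htc ▸ iUnion_mono fun b => subset_closure)
  · obtain ⟨x, hx⟩ := hts b
    exact ⟨a x, (closure_mono hx).trans (hV x)⟩

theorem HasLocallyFiniteRefinements.paracompactSpace {X : Type u} [TopologicalSpace X]
    [RegularSpace X] (h : HasLocallyFiniteRefinements X) : ParacompactSpace X where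
  locallyFinite_refinement := by
    intro α s ho hc
    obtain ⟨β, A, hAc, hAl, hAs⟩ := h α s ho hc
    choose a ha using hAs
    have h1 : ∀ x, ∃ G, IsOpen G ∧ x ∈ G ∧ {b | (A b ∩ G).Nonempty}.Finite := fun x => by
      obtain ⟨G, hG, hGf⟩ := hAl x
      obtain ⟨G', hG', hGo, hx⟩ := mem_nhds_iff.1 hG
      exact ⟨G', hGo, hx, hGf.subset fun b hb => hb.mono (inter_subset_inter_right _ hG')⟩
    choose G hGo hxG hGf using h1
    obtain ⟨γ, C, hCcl, hCc, hCl, hCs⟩ :=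
      h.exists_closed X G hGo (iUnion_eq_univ_iff.2 fun x => ⟨x, hxG x⟩)
    choose y hy using hCs
    have hCx : ∀ x, ∃ c, x ∈ C c := fun x => iUnion_eq_univ_iff.1 hCc x
    -- `S b` removes every closed piece `C c` that misses `A b`. Hence a piece meeting `S b` also
    -- meets `A b`, and each piece meets only finitely many `A b`.
    let S : β → Set X := fun b => (⋃ c : {c // ¬ (C c ∩ A b).Nonempty}, C c)ᶜ
    have hSo : ∀ b, IsOpen (S b) := fun b =>
      ((hCl.comp_injective Subtype.val_injective).isClosed_iUnion fun c => hCcl c.1).isOpen_compl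
    have hAS : ∀ b, A b ⊆ S b := fun b x hx hx' => by
      obtain ⟨c, hc⟩ := mem_iUnion.1 hx'
      exact c.2 ⟨x, hc, hx⟩
    refine ⟨β, fun b => S b ∩ s (a b), fun b => (hSo b).inter (ho _), ?_, fun x => ?_,
      fun b => ⟨a b, inter_subset_right⟩⟩
    · exact eq_univ_of_univ_subset (hAc ▸ iUnion_mono fun b => subset_inter (hAS b) (ha b))
    · obtain ⟨H, hH, hHf⟩ := hCl x
      refine ⟨H, hH, (hHf.biUnion fun c _ => hGf (y c)).subset ?_⟩
      rintro b ⟨z, ⟨hzS, -⟩, hzH⟩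
      obtain ⟨c, hzc⟩ := hCx z
      refine mem_biUnion (x := c) ⟨z, hzc, hzH⟩ ?_
      by_contra hne
      refine hzS (mem_iUnion.2 ⟨⟨c, fun ⟨w, hw⟩ => hne ⟨w, hw.2, hy c hw.1⟩⟩, hzc⟩)

/-- **Michael's theorem**: a regular space in which every open cover has a `σ`-locally finite open
refinement is paracompact. -/
theorem paracompactSpace_of_sigma_locallyFinite {X : Type u} [TopologicalSpace X]
    [RegularSpace X]
    (h : ∀ (α : Type u) (s : α → Set X), (∀ a, IsOpen (s a)) → ⋃ a, s a = univ →
      ∃ (β : ℕ → Type u) (t : ∀ n, β n → Set X), (∀ n b, IsOpen (t n b)) ∧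
        (∀ x, ∃ n b, x ∈ t n b) ∧ (∀ n, LocallyFinite (t n)) ∧ ∀ n b, ∃ a, t n b ⊆ s a) :
    ParacompactSpace X := by
  refine HasLocallyFiniteRefinements.paracompactSpace fun α s ho hc => ?_
  obtain ⟨β, t, hto, htc, htl, hts⟩ := h α s ho hc
  refine ⟨Σ n, β n, fun i => t i.1 i.2 \ ⋃ m < i.1, ⋃ c, t m c, ?_, fun x => ?_, fun i => ?_⟩
  · refine iUnion_eq_univ_iff.2 fun x => ?_
    classical
    obtain ⟨b, hb⟩ := Nat.find_spec (htc x)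
    refine ⟨⟨_, b⟩, hb, fun hx => ?_⟩
    simp only [mem_iUnion] at hx
    obtain ⟨m, hm, c, hc⟩ := hx
    exact Nat.find_min (htc x) hm ⟨c, hc⟩
  · obtain ⟨k, b, hb⟩ := htc x
    choose G hG hGf using fun n => htl n x
    -- The open set `t k b` misses all pieces of level above `k`, so only finitely many levels
    -- remain to be controlled.
    refine ⟨t k b ∩ ⋂ m ∈ Iic k, G m, inter_mem ((hto k b).mem_nhds hb)
      ((biInter_mem (finite_Iic k)).2 fun m _ => hG m), ?_⟩
    refine ((finite_Iic k).biUnion fun m _ => (hGf m).image (Sigma.mk m)).subset ?_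
    rintro ⟨n, c⟩ ⟨z, ⟨hz1, hz2⟩, hz3, hz4⟩
    have hn : n ≤ k := by
      by_contra hlt
      exact hz2 (mem_biUnion (not_le.1 hlt) (mem_iUnion.2 ⟨b, hz3⟩))
    exact mem_biUnion (x := n) hn ⟨c, ⟨z, hz1, mem_iInter₂.1 hz4 n hn⟩, rfl⟩
  · obtain ⟨a, ha⟩ := hts i.1 i.2
    exact ⟨a, sdiff_subset.trans ha⟩

/-! ### Families with locally finite open expansions. -/

/-- A family of sets whose members expand to a locally finite family of open sets. -/
def HasOpenExpansion {X : Type u} [TopologicalSpace X] (𝒟 : Set (Set X)) : Prop :=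
  ∃ V : Set X → Set X, (∀ D ∈ 𝒟, IsOpen (V D) ∧ D ⊆ V D) ∧ LocallyFinite fun D : 𝒟 => V D

/-- A countable union of families that expand to locally finite families of open sets. -/
def HasSigmaOpenExpansion {X : Type u} [TopologicalSpace X] (𝒟 : Set (Set X)) : Prop :=
  ∃ 𝒢 : ℕ → Set (Set X), 𝒟 = ⋃ n, 𝒢 n ∧ ∀ n, HasOpenExpansion (𝒢 n)

section Expansion

variable {X : Type u} [TopologicalSpace X]

theorem HasOpenExpansion.mono {𝒟 𝒢 : Set (Set X)} (h : HasOpenExpansion 𝒟) (hs : 𝒢 ⊆ 𝒟) :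
    HasOpenExpansion 𝒢 := by
  obtain ⟨V, hV, hl⟩ := h
  exact ⟨V, fun D hD => hV D (hs hD), hl.comp_injective (inclusion_injective hs)⟩

/-- Several indices may give the same set; choosing one index per set is injective, so local
finiteness is inherited from `V`. -/
theorem HasOpenExpansion.of_index {ι : Type*} {D V : ι → Set X} (hV : ∀ i, IsOpen (V i))
    (hD : ∀ i, D i ⊆ V i) (hl : LocallyFinite V) : HasOpenExpansion (range D) := by
  classical
  have hex : ∀ A : range D, ∃ i, D i = A := fun A => A.2
  choose i hi using hex
  refine ⟨fun A => if h : A ∈ range D then V (i ⟨A, h⟩) else univ, ?_, ?_⟩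
  · intro A hA
    simp only [hA, dif_pos]
    exact ⟨hV _, (hi ⟨A, hA⟩).symm.subset.trans (hD _)⟩
  · have hinj : Function.Injective i := fun A B hAB => Subtype.ext (by rw [← hi A, ← hi B, hAB])
    convert hl.comp_injective hinj using 2 with A
    simp [A.2]

theorem HasOpenExpansion.singleton (A : Set X) : HasOpenExpansion {A} :=
  ⟨fun _ => univ, fun _ _ => ⟨isOpen_univ, subset_univ _⟩, locallyFinite_of_finite _⟩

theorem HasOpenExpansion.image2_inter {𝒟 𝒢 : Set (Set X)} (h : HasOpenExpansion 𝒟)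
    (h' : HasOpenExpansion 𝒢) : HasOpenExpansion (image2 (· ∩ ·) 𝒟 𝒢) := by
  obtain ⟨V, hV, hl⟩ := h
  obtain ⟨V', hV', hl'⟩ := h'
  have : image2 (· ∩ ·) 𝒟 𝒢 = range fun p : 𝒟 × 𝒢 => (p.1 : Set X) ∩ p.2 := by
    ext A; simp [mem_image2]
  rw [this]
  refine .of_index (V := fun p : 𝒟 × 𝒢 => V p.1 ∩ V' p.2)
    (fun p => (hV _ p.1.2).1.inter (hV' _ p.2.2).1)
    (fun p => inter_subset_inter (hV _ p.1.2).2 (hV' _ p.2.2).2) fun x => ?_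
  obtain ⟨G, hG, hGf⟩ := hl x
  obtain ⟨G', hG', hGf'⟩ := hl' x
  refine ⟨G ∩ G', inter_mem hG hG', (hGf.prod hGf').subset ?_⟩
  rintro p ⟨z, ⟨h1, h2⟩, h3, h4⟩
  exact ⟨⟨z, h1, h3⟩, ⟨z, h2, h4⟩⟩

theorem HasSigmaOpenExpansion.of_countable {ι : Type*} [Countable ι] {𝒢 : ι → Set (Set X)}
    (h : ∀ i, HasOpenExpansion (𝒢 i)) : HasSigmaOpenExpansion (⋃ i, 𝒢 i) := by
  rcases isEmpty_or_nonempty ι with hι | hι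
  · refine ⟨fun _ => ∅, by simp, fun _ => (HasOpenExpansion.singleton ∅).mono (empty_subset _)⟩
  · obtain ⟨f, hf⟩ := exists_surjective_nat ι
    exact ⟨fun n => 𝒢 (f n), (hf.iUnion_comp 𝒢).symm, fun n => h _⟩

theorem HasSigmaOpenExpansion.iUnion {ι : Type*} [Countable ι] {𝒢 : ι → Set (Set X)}
    (h : ∀ i, HasSigmaOpenExpansion (𝒢 i)) : HasSigmaOpenExpansion (⋃ i, 𝒢 i) := by
  choose 𝒟 hD hE using h
  have : ⋃ i, 𝒢 i = ⋃ p : ι × ℕ, 𝒟 p.1 p.2 := by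
    rw [iUnion_prod']
    exact iUnion_congr hD
  rw [this]
  exact .of_countable fun p => hE _ _

theorem HasSigmaOpenExpansion.image2_inter {𝒟 𝒢 : Set (Set X)} (h : HasSigmaOpenExpansion 𝒟)
    (h' : HasSigmaOpenExpansion 𝒢) : HasSigmaOpenExpansion (image2 (· ∩ ·) 𝒟 𝒢) := by
  obtain ⟨A, rfl, hA⟩ := h
  obtain ⟨B, rfl, hB⟩ := h'
  have : image2 (· ∩ ·) (⋃ n, A n) (⋃ n, B n) =
      ⋃ p : ℕ × ℕ, image2 (· ∩ ·) (A p.1) (B p.2) := by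
    rw [iUnion_prod', image2_iUnion_left]
    exact iUnion_congr fun n => image2_iUnion_right _ _ _
  rw [this]
  exact .of_countable fun p => (hA _).image2_inter (hB _)

/-- Finite intersections of members of a family. -/
def finiteInters (𝒟 : Set (Set X)) : Set (Set X) :=
  {A | ∃ s : Set (Set X), s.Finite ∧ s ⊆ 𝒟 ∧ A = ⋂₀ s}

end Expansion

theorem finiteInters_countable {X : Type u} {𝒟 : Set (Set X)} (h : 𝒟.Countable) :
    (finiteInters 𝒟).Countable := by
  refine ((countable_ofPred_finite_subset h).image sInter).mono ?_
  rintro A ⟨s, hs, hsD, rfl⟩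
  exact ⟨s, ⟨hs, hsD⟩, rfl⟩

theorem HasSigmaOpenExpansion.finiteInters {X : Type u} [TopologicalSpace X] {𝒟 : Set (Set X)}
    (h : HasSigmaOpenExpansion 𝒟) : HasSigmaOpenExpansion (finiteInters 𝒟) := by
  -- `T n` collects intersections of `n` members, repetitions allowed, so that induction on `n`
  -- applies.
  let T : ℕ → Set (Set X) := fun n => (image2 (· ∩ ·) 𝒟)^[n] {univ}
  have hT0 : T 0 = {univ} := rfl
  have hTs : ∀ n, T (n + 1) = image2 (· ∩ ·) 𝒟 (T n) := fun n =>
    Function.iterate_succ_apply' _ _ _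
  have hT : ∀ n, HasSigmaOpenExpansion (T n) := fun n => by
    induction n with
    | zero =>
      rw [hT0, ← iUnion_const (ι := Unit) ({univ} : Set (Set X))]
      exact .of_countable fun _ => .singleton _
    | succ n ih => rw [hTs]; exact h.image2_inter ih
  have : _root_.finiteInters 𝒟 = ⋃ n, T n := by
    refine Subset.antisymm ?_ (iUnion_subset fun n => ?_)
    · rintro A ⟨s, hs, hsD, rfl⟩
      induction s, hs using Set.Finite.induction_on with
      | empty => exact mem_iUnion.2 ⟨0, by simp [hT0]⟩
      | @insert a s _ _ ih =>
        obtain ⟨n, hn⟩ := mem_iUnion.1 (ih ((subset_insert _ _).trans hsD))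
        refine mem_iUnion.2 ⟨n + 1, ?_⟩
        rw [hTs, sInter_insert]
        exact mem_image2_of_mem (hsD (mem_insert _ _)) hn
    · induction n with
      | zero =>
        rintro A rfl
        exact ⟨∅, finite_empty, empty_subset _, by simp⟩
      | succ n ih =>
        rw [hTs]
        rintro _ ⟨a, ha, B, hB, rfl⟩
        obtain ⟨s, hs, hsD, rfl⟩ := ih hB
        exact ⟨insert a s, hs.insert a, insert_subset ha hsD, by simp⟩
  rw [this]
  exact .iUnion hT

theorem HasSigmaOpenExpansion.isSigmaLocallyFinite {X : Type u} [TopologicalSpace X]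
    {𝒟 : Set (Set X)} (h : HasSigmaOpenExpansion 𝒟) : IsSigmaLocallyFinite 𝒟 := by
  obtain ⟨𝒢, h1, h2⟩ := h
  refine ⟨𝒢, h1, fun n => ?_⟩
  obtain ⟨V, hV, hl⟩ := h2 n
  exact hl.subset fun D => (hV D D.2).2

/-- Testing the `cp`-network with `A = {x}` shows that it is a network. The members lying in some
element of the cover therefore cover the space; their expansions, cut down by that element, form the
refinement required by Michael's theorem. -/
theorem HasSigmaOpenExpansion.paracompactSpace {X : Type u} [TopologicalSpace X]
    [RegularSpace X] {𝒟 : Set (Set X)} (h : HasSigmaOpenExpansion 𝒟) (hD : IsCpNetwork 𝒟) :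
    ParacompactSpace X := by
  obtain ⟨𝒢, rfl, h2⟩ := h
  choose V hV hl using h2
  refine paracompactSpace_of_sigma_locallyFinite fun α s ho hc => ?_
  refine ⟨fun n => {D : 𝒢 n // ∃ a, (D : Set X) ⊆ s a}, fun n D => V n D.1 ∩ s D.2.choose,
    fun n D => (hV n _ D.1.2).1.inter (ho _), fun x => ?_,
    fun n => ((hl n).comp_injective Subtype.val_injective).subset fun D => inter_subset_left,
    fun n D => ⟨_, inter_subset_right⟩⟩
  obtain ⟨a, ha⟩ := iUnion_eq_univ_iff.1 hc x
  obtain ⟨D, hD, hxD, hDs, -⟩ := hD x (s a) ((ho a).mem_nhds ha) {x} (subset_closure rfl)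
  obtain ⟨n, hn⟩ := mem_iUnion.1 hD
  have hex : ∃ a, D ⊆ s a := ⟨a, hDs⟩
  exact ⟨n, ⟨⟨D, hn⟩, hex⟩, (hV n D hn).2 hxD, hex.choose_spec hxD⟩

theorem IsSigmaLocallyFinite.countable {X : Type u} [TopologicalSpace X] [LindelofSpace X]
    {𝒟 : Set (Set X)} (h : IsSigmaLocallyFinite 𝒟) : 𝒟.Countable := by
  obtain ⟨𝒢, rfl, hl⟩ := h
  refine countable_iUnion fun n => ?_
  choose G hG hGf using hl n
  obtain ⟨t, ht, hc⟩ := LindelofSpace.elim_nhds_subcover G hG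
  have h1 : (⋃ x ∈ t, Subtype.val '' {D : 𝒢 n | ((D : Set X) ∩ G x).Nonempty}).Countable :=
    ht.biUnion fun x _ => ((hGf x).image _).countable
  -- The empty set meets no neighborhood and has to be added by hand.
  refine (h1.insert ∅).mono fun D hD => ?_
  rcases D.eq_empty_or_nonempty with rfl | ⟨z, hz⟩
  · exact mem_insert _ _
  · obtain ⟨x, hx, hzx⟩ := mem_iUnion₂.1 (hc ▸ mem_univ z : z ∈ ⋃ x ∈ t, G x)
    exact mem_insert_of_mem _ (mem_biUnion hx ⟨⟨D, hD⟩, ⟨z, hz, hzx⟩, rfl⟩)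

/-- The **Nagata–Smirnov** base of a metrizable space. -/
theorem exists_sigma_locallyFinite_base (Y : Type u) [TopologicalSpace Y]
    [TopologicalSpace.MetrizableSpace Y] :
    ∃ ℬ : ℕ → Set (Set Y), (∀ n, ∀ B ∈ ℬ n, IsOpen B) ∧
      (∀ n, LocallyFinite fun B : ℬ n => (B : Set Y)) ∧
      ∀ y, ∀ U ∈ 𝓝 y, ∃ n, ∃ B ∈ ℬ n, y ∈ B ∧ B ⊆ U := by
  let _ := TopologicalSpace.metrizableSpaceMetric Y
  have h1 : ∀ n : ℕ, ∃ v : Y → Set Y, (∀ a, IsOpen (v a)) ∧ ⋃ a, v a = univ ∧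
      LocallyFinite v ∧ ∀ a, v a ⊆ Metric.ball a (1 / (n + 1)) := fun n =>
    precise_refinement _ (fun a => Metric.isOpen_ball)
      (iUnion_eq_univ_iff.2 fun y => ⟨y, Metric.mem_ball_self (by positivity)⟩)
  choose v hvo hvc hvl hvs using h1
  refine ⟨fun n => range (v n), fun n => forall_mem_range.2 (hvo n), fun n => (hvl n).on_range,
    fun y U hU => ?_⟩
  obtain ⟨ε, hε, hεU⟩ := Metric.mem_nhds_iff.1 hU
  obtain ⟨n, hn⟩ := exists_nat_one_div_lt (half_pos hε)
  obtain ⟨a, ha⟩ := iUnion_eq_univ_iff.1 (hvc n) y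
  refine ⟨n, v n a, mem_range_self a, ha, fun z hz => hεU ?_⟩
  have h2 := Metric.mem_ball.1 (hvs n a ha)
  have h3 := Metric.mem_ball.1 (hvs n a hz)
  rw [Metric.mem_ball]
  linarith [dist_triangle_right z y a]

/-! ### Countable `k`-networks. -/

/-- A space has a *countable `k`-network* if some countable family of sets interpolates between
each compact set and each of its open neighborhoods. -/
def HasCountableKNetwork (X : Type u) [TopologicalSpace X] : Prop :=
  ∃ 𝒩 : Set (Set X), 𝒩.Countable ∧
    ∀ K U, IsCompact K → IsOpen U → K ⊆ U → ∃ N ∈ 𝒩, K ⊆ N ∧ N ⊆ U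

theorem HasCountableKNetwork.of_finite {X : Type u} [TopologicalSpace X] {𝒩 : Set (Set X)}
    (hc : 𝒩.Countable)
    (h : ∀ K U, IsCompact K → IsOpen U → K ⊆ U →
      ∃ s : Set (Set X), s.Finite ∧ s ⊆ 𝒩 ∧ K ⊆ ⋃₀ s ∧ ⋃₀ s ⊆ U) :
    HasCountableKNetwork X := by
  refine ⟨sUnion '' {s | s.Finite ∧ s ⊆ 𝒩}, (countable_ofPred_finite_subset hc).image _, ?_⟩
  intro K U hK hU hKU
  obtain ⟨s, hs, hsN, h1, h2⟩ := h K U hK hU hKU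
  exact ⟨_, ⟨s, ⟨hs, hsN⟩, rfl⟩, h1, h2⟩

theorem HasCountableKNetwork.punit : HasCountableKNetwork PUnit.{u + 1} :=
  ⟨univ, to_countable _, fun K _ _ _ h => ⟨K, mem_univ _, Subset.rfl, h⟩⟩

theorem HasCountableKNetwork.sum {X Y : Type u} [TopologicalSpace X] [TopologicalSpace Y]
    (hX : HasCountableKNetwork X) (hY : HasCountableKNetwork Y) :
    HasCountableKNetwork (X ⊕ Y) := by
  obtain ⟨𝒩, hc, h⟩ := hX
  obtain ⟨ℳ, hc', h'⟩ := hY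
  refine ⟨image2 (fun N M => Sum.inl '' N ∪ Sum.inr '' M) 𝒩 ℳ, hc.image2 hc' _, ?_⟩
  intro K U hK hU hKU
  obtain ⟨N, hN, hKN, hNU⟩ := h (Sum.inl ⁻¹' K) (Sum.inl ⁻¹' U)
    (IsClosedEmbedding.inl.isCompact_preimage hK) (hU.preimage continuous_inl)
    (preimage_mono hKU)
  obtain ⟨M, hM, hKM, hMU⟩ := h' (Sum.inr ⁻¹' K) (Sum.inr ⁻¹' U)
    (IsClosedEmbedding.inr.isCompact_preimage hK) (hU.preimage continuous_inr)
    (preimage_mono hKU)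
  refine ⟨_, mem_image2_of_mem hN hM, ?_, union_subset (image_subset_iff.2 hNU)
    (image_subset_iff.2 hMU)⟩
  rintro (x | x) hx
  · exact Or.inl ⟨x, hKN hx, rfl⟩
  · exact Or.inr ⟨x, hKM hx, rfl⟩

theorem IsCompact.exists_finite_sigma {ι : Type*} {X : ι → Type*} [∀ i, TopologicalSpace (X i)]
    {K : Set (Σ i, X i)} (hK : IsCompact K) : ∃ t : Finset ι, ∀ z ∈ K, z.1 ∈ t := by
  obtain ⟨t, ht⟩ := hK.elim_finite_subcover (fun i => range (Sigma.mk i))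
    (fun i => isOpen_range_sigmaMk) fun z _ => mem_iUnion.2 ⟨z.1, z.2, rfl⟩
  refine ⟨t, fun z hz => ?_⟩
  obtain ⟨i, hi, x, rfl⟩ := mem_iUnion₂.1 (ht hz)
  exact hi

theorem IsCompact.preimage_sigmaMk {ι : Type*} {X : ι → Type*} [∀ i, TopologicalSpace (X i)]
    {K : Set (Σ i, X i)} (hK : IsCompact K) (i : ι) : IsCompact (Sigma.mk i ⁻¹' K) :=
  IsClosedEmbedding.sigmaMk.isCompact_preimage hK

theorem HasCountableKNetwork.sigma {ι : Type} [Countable ι] {X : ι → Type u}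
    [∀ i, TopologicalSpace (X i)] (hX : ∀ i, HasCountableKNetwork (X i)) :
    HasCountableKNetwork (Σ i, X i) := by
  choose 𝒩 hc h using hX
  refine .of_finite (𝒩 := ⋃ i, image (Sigma.mk i) '' 𝒩 i)
    (countable_iUnion fun i => (hc i).image _) fun K U hK hU hKU => ?_
  obtain ⟨t, ht⟩ := hK.exists_finite_sigma
  choose N hN hKN hNU using fun i => h i (Sigma.mk i ⁻¹' K) (Sigma.mk i ⁻¹' U)
    (hK.preimage_sigmaMk i) (hU.preimage continuous_sigmaMk) (preimage_mono hKU)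
  refine ⟨(fun i => Sigma.mk i '' N i) '' t, t.finite_toSet.image _, ?_, ?_, ?_⟩
  · rintro _ ⟨i, -, rfl⟩
    exact mem_iUnion.2 ⟨i, N i, hN i, rfl⟩
  · rintro ⟨i, x⟩ hx
    exact ⟨_, ⟨i, ht _ hx, rfl⟩, x, hKN i hx, rfl⟩
  · refine sUnion_subset ?_
    rintro _ ⟨i, -, rfl⟩
    exact image_subset_iff.2 (hNU i)

theorem IsCompact.exists_isCompact_mem_nhdsWithin {W : Type*} [TopologicalSpace W] [T2Space W]
    {K : Set W} (hK : IsCompact K) {x : W} (hx : x ∈ K) {V : Set W} (hV : V ∈ 𝓝[K] x) :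
    ∃ V' ∈ 𝓝[K] x, V' ⊆ V ∧ IsCompact V' := by
  have := isCompact_iff_compactSpace.1 hK
  have h1 : (Subtype.val ⁻¹' V : Set K) ∈ 𝓝 (⟨x, hx⟩ : K) := preimage_coe_mem_nhds_subtype.2 hV
  obtain ⟨M, hM, hMV, hMc⟩ := local_compact_nhds h1
  exact ⟨Subtype.val '' M, mem_nhds_subtype_iff_nhdsWithin.1 hM, image_subset_iff.2 hMV,
    hMc.image continuous_subtype_val⟩

/-- A compact subset of a product of Hausdorff spaces is covered by finitely many compact boxes
that lie in a given relative neighborhood. -/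
theorem IsCompact.exists_finite_boxes {Z X : Type*} [TopologicalSpace Z] [TopologicalSpace X]
    [T2Space Z] [T2Space X] {C P : Set (Z × X)} (hC : IsCompact C)
    (hP : ∀ c ∈ C, P ∈ 𝓝[(Prod.fst '' C) ×ˢ (Prod.snd '' C)] c) :
    ∃ t : Set (Set Z × Set X), t.Finite ∧ (∀ q ∈ t, IsCompact q.1 ∧ IsCompact q.2) ∧
      (∀ c ∈ C, ∃ q ∈ t, c ∈ q.1 ×ˢ q.2) ∧ ∀ q ∈ t, q.1 ×ˢ q.2 ⊆ P := by
  have hCs : C ⊆ (Prod.fst '' C) ×ˢ (Prod.snd '' C) := fun c hc => ⟨⟨c, hc, rfl⟩, ⟨c, hc, rfl⟩⟩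
  have h1 : ∀ c ∈ C, ∃ q : Set Z × Set X, q.1 ×ˢ q.2 ∈ 𝓝[C] c ∧ IsCompact q.1 ∧ IsCompact q.2 ∧
      q.1 ×ˢ q.2 ⊆ P := fun c hc => by
    have h2 := hP c hc
    rw [← Prod.mk.eta (p := c), nhdsWithin_prod_eq, mem_prod_iff] at h2
    obtain ⟨V, hV, W, hW, hVW⟩ := h2
    obtain ⟨V', hV', hVV, hVc⟩ := (hC.image continuous_fst).exists_isCompact_mem_nhdsWithin
      ⟨c, hc, rfl⟩ hV
    obtain ⟨W', hW', hWW, hWc⟩ := (hC.image continuous_snd).exists_isCompact_mem_nhdsWithin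
      ⟨c, hc, rfl⟩ hW
    refine ⟨(V', W'), nhdsWithin_mono c hCs ?_, hVc, hWc, (prod_mono hVV hWW).trans hVW⟩
    rw [← Prod.mk.eta (p := c), nhdsWithin_prod_eq]
    exact prod_mem_prod hV' hW'
  choose! q hq hq1 hq2 hqP using h1
  obtain ⟨t, htC, ht⟩ := hC.elim_nhdsWithin_subcover (fun c => (q c).1 ×ˢ (q c).2) hq
  refine ⟨q '' t, t.finite_toSet.image q, ?_, fun c hc => ?_, ?_⟩
  · rintro _ ⟨c, hc, rfl⟩
    exact ⟨hq1 c (htC c hc), hq2 c (htC c hc)⟩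
  · obtain ⟨d, hd, hcd⟩ := mem_iUnion₂.1 (ht hc)
    exact ⟨q d, ⟨d, hd, rfl⟩, hcd⟩
  · rintro _ ⟨c, hc, rfl⟩
    exact hqP c (htC c hc)

theorem HasCountableKNetwork.prod {Z X : Type u} [TopologicalSpace Z] [TopologicalSpace X]
    [T2Space Z] [T2Space X] (hZ : HasCountableKNetwork Z) (hX : HasCountableKNetwork X) :
    HasCountableKNetwork (Z × X) := by
  obtain ⟨𝒩, hc, h⟩ := hZ
  obtain ⟨ℳ, hc', h'⟩ := hX
  refine .of_finite (hc.image2 hc' (fun N M => N ×ˢ M)) fun C U hC hU hCU => ?_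
  obtain ⟨t, htf, htc, htC, htU⟩ := hC.exists_finite_boxes
    fun c hc => mem_nhdsWithin_of_mem_nhds (hU.mem_nhds (hCU hc))
  have h1 : ∀ q ∈ t, ∃ N ∈ 𝒩, ∃ M ∈ ℳ, q.1 ×ˢ q.2 ⊆ N ×ˢ M ∧ N ×ˢ M ⊆ U := fun q hq => by
    obtain ⟨V, W, hV, hW, hqV, hqW, hVW⟩ :=
      generalized_tube_lemma (htc q hq).1 (htc q hq).2 hU (htU q hq)
    obtain ⟨N, hN, hqN, hNV⟩ := h _ _ (htc q hq).1 hV hqV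
    obtain ⟨M, hM, hqM, hMW⟩ := h' _ _ (htc q hq).2 hW hqW
    exact ⟨N, hN, M, hM, prod_mono hqN hqM, (prod_mono hNV hMW).trans hVW⟩
  choose! N hN M hM hqs hsU using h1
  refine ⟨(fun q => N q ×ˢ M q) '' t, htf.image _, ?_, fun c hc => ?_, ?_⟩
  · rintro _ ⟨q, hq, rfl⟩
    exact mem_image2_of_mem (hN q hq) (hM q hq)
  · obtain ⟨q, hq, hcq⟩ := htC c hc
    exact ⟨_, ⟨q, hq, rfl⟩, hqs q hq hcq⟩
  · refine sUnion_subset ?_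
    rintro _ ⟨q, hq, rfl⟩
    exact hsU q hq

/-- A countable `cp`-network yields a countable `k`-network. -/
theorem IsCpNetwork.hasCountableKNetwork {X : Type u} [TopologicalSpace X] [T1Space X]
    {𝒟 : Set (Set X)} (hD : IsCpNetwork 𝒟) (hc : 𝒟.Countable) : HasCountableKNetwork X := by
  refine .of_finite hc fun K U hK hU hKU => ?_
  by_contra! hne
  have hne : ∀ s : Set (Set X), s.Finite → s ⊆ {D ∈ 𝒟 | D ⊆ U} → ∃ x ∈ K, x ∉ ⋃₀ s := by
    intro s hs hsD
    by_contra! hcon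
    exact hne s hs (fun D hD => (hsD hD).1) hcon (sUnion_subset fun D hD => (hsD hD).2)
  have hc' : {D ∈ 𝒟 | D ⊆ U}.Countable := hc.mono fun D hD => hD.1
  obtain ⟨x₀, hx₀, -⟩ := hne ∅ finite_empty (empty_subset _)
  obtain ⟨D₀, hD₀, -, hD₀U, -⟩ := hD x₀ U (hU.mem_nhds (hKU hx₀)) {x₀} (subset_closure rfl)
  obtain ⟨f, hf⟩ := hc'.exists_eq_range ⟨D₀, hD₀, hD₀U⟩
  -- Here `x n` avoids the first `n + 1` members contained in `U`. Each member then meets the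
  -- sequence in a finite set, which the `cp`-property forbids at an accumulation point.
  have h1 : ∀ n : ℕ, ∃ x ∈ K, x ∉ ⋃₀ (f '' Iic n) := fun n =>
    hne _ ((finite_Iic n).image f) (hf ▸ image_subset_range _ _)
  choose x hxK hx using h1
  have hfx : ∀ m n, x n ∈ f m → n < m := fun m n hmn => by
    by_contra! hle
    exact hx n ⟨f m, ⟨m, hle, rfl⟩, hmn⟩
  have hfin : ∀ m, (f m ∩ range x).Finite := fun m => by
    refine ((finite_Iio m).image x).subset ?_
    rintro _ ⟨hy, n, rfl⟩
    exact ⟨n, hfx m n hy, rfl⟩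
  have hmem : ∀ y ∈ K, ∀ A, y ∈ closure A → ∃ m, y ∈ f m ∧ (AccPt y (𝓟 A) → (f m ∩ A).Infinite) := by
    intro y hy A hA
    obtain ⟨D, hD, hyD, hDU, hacc⟩ := hD y U (hU.mem_nhds (hKU hy)) A hA
    obtain ⟨m, rfl⟩ : D ∈ range f := hf ▸ ⟨hD, hDU⟩
    exact ⟨m, hyD, hacc⟩
  -- If there were finitely many values, members containing them would have bounded indices, and a
  -- late `x n` avoids all of those members.
  have hinf : (range x).Infinite := fun hfinite => by
    have h2 : ∀ y : X, ∃ m, y ∈ K → y ∈ f m := fun y => by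
      by_cases hy : y ∈ K
      · obtain ⟨m, hm, -⟩ := hmem y hy {y} (subset_closure rfl)
        exact ⟨m, fun _ => hm⟩
      · exact ⟨0, fun h => absurd h hy⟩
    choose m hm using h2
    obtain ⟨b, hb⟩ := (hfinite.image m).bddAbove
    have h3 := hfx _ _ (hm (x b) (hxK b))
    exact absurd (hb ⟨x b, ⟨b, rfl⟩, rfl⟩) (not_le.2 h3)
  obtain ⟨y, hyK, hy⟩ := hinf.exists_accPt_of_subset_isCompact hK (range_subset_iff.2 hxK)
  have hy : AccPt y (𝓟 (range x)) := hy
  obtain ⟨m, -, hm⟩ := hmem y hyK (range x) (mem_closure_iff_clusterPt.2 hy.clusterPt)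
  exact hm hy (hfin m)

/-! ### Representations by maps continuous on compact sets. -/

/-- A representation of `E` as a space of maps `X → Y` that are continuous on compact sets, with
the compact-open topology. -/
structure IsKRep {E X Y : Type*} [TopologicalSpace E] [TopologicalSpace X] [TopologicalSpace Y]
    (φ : E → X → Y) : Prop where
  injective : Function.Injective φ
  continuousOn : ∀ e K, IsCompact K → ContinuousOn (φ e) K
  eventually : ∀ e K U, IsCompact K → IsOpen U → MapsTo (φ e) K U →
    ∀ᶠ e' in 𝓝 e, MapsTo (φ e') K U
  le_nhds : ∀ (e : E) (l : Filter E), (∀ K U, IsCompact K → IsOpen U → MapsTo (φ e) K U →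
    ∀ᶠ e' in l, MapsTo (φ e') K U) → l ≤ 𝓝 e

/-- The class of spaces of maps from spaces with a countable `k`-network to metrizable spaces,
which are second-countable if `p` holds. -/
def kClass (p : Prop) : SpaceClass.{u} := fun E _ =>
  ∃ (X Y : Type u) (_ : TopologicalSpace X) (_ : TopologicalSpace Y) (φ : E → X → Y),
    T2Space X ∧ HasCountableKNetwork X ∧ TopologicalSpace.MetrizableSpace Y ∧
    (p → SecondCountableTopology Y) ∧ IsKRep φ

theorem kClass_of_metrizable {p : Prop} (Y : Type u) [TopologicalSpace Y]
    [TopologicalSpace.MetrizableSpace Y] (h : p → SecondCountableTopology Y) : kClass p Y := by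
  refine ⟨PUnit, Y, inferInstance, inferInstance, fun y _ => y, inferInstance, .punit,
    inferInstance, h, ⟨fun y z hyz => congrFun hyz ⟨⟩, fun _ _ _ => continuousOn_const,
    fun e K U _ hU he => ?_, fun e l hl => ?_⟩⟩
  · rcases K.eq_empty_or_nonempty with rfl | ⟨x, hx⟩
    · exact .of_forall fun _ => mapsTo_empty _ _
    · filter_upwards [hU.mem_nhds (he hx)] with e' he' _ _ using he'
  · refine (nhds_basis_opens e).ge_iff.2 fun U hU => ?_
    exact (hl univ U isCompact_univ hU.2 fun _ _ => hU.1).mono fun e' he' => he' (mem_univ ⟨⟩)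

/-- A representation need not be surjective onto any set of maps, so restricting it costs nothing.
-/
theorem kClass_of_isEmbedding {p : Prop} {E F : Type u} [TopologicalSpace E] [TopologicalSpace F]
    {g : F → E} (hg : IsEmbedding g) (h : kClass p E) : kClass p F := by
  obtain ⟨X, Y, _, _, φ, h1, h2, h3, h4, hφ⟩ := h
  refine ⟨X, Y, _, _, fun e => φ (g e), h1, h2, h3, h4, hφ.injective.comp hg.injective,
    fun e => hφ.continuousOn _, fun e K U hK hU he => ?_, fun e l hl => ?_⟩
  · exact hg.continuous.continuousAt.eventually (hφ.eventually _ K U hK hU he)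
  · rw [hg.nhds_eq_comap, ← map_le_iff_le_comap]
    exact hφ.le_nhds _ _ hl

theorem metrizableSpace_sigma {ι : Type*} {Y : ι → Type*} [∀ i, TopologicalSpace (Y i)]
    [∀ i, TopologicalSpace.MetrizableSpace (Y i)] :
    TopologicalSpace.MetrizableSpace (Σ i, Y i) := by
  let _ := fun i => TopologicalSpace.metrizableSpaceMetric (Y i)
  let _ := Metric.Sigma.metricSpace (E := Y)
  infer_instance

theorem metrizableSpace_sum {X Y : Type*} [TopologicalSpace X] [TopologicalSpace Y]
    [TopologicalSpace.MetrizableSpace X] [TopologicalSpace.MetrizableSpace Y] :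
    TopologicalSpace.MetrizableSpace (X ⊕ Y) := by
  let _ := TopologicalSpace.metrizableSpaceMetric X
  let _ := TopologicalSpace.metrizableSpaceMetric Y
  let _ := Metric.metricSpaceSum (X := X) (Y := Y)
  infer_instance

theorem IsKRep.continuous_apply {E X Y : Type*} [TopologicalSpace E] [TopologicalSpace X]
    [TopologicalSpace Y] {φ : E → X → Y} (h : IsKRep φ) (x : X) : Continuous fun e => φ e x := by
  refine continuous_iff_continuousAt.2 fun e => ?_
  refine (nhds_basis_opens (φ e x)).ge_iff.2 fun U hU => ?_
  exact (h.eventually e {x} U isCompact_singleton hU.2 (by simpa using hU.1)).mono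
    fun e' he' => he' rfl

theorem IsKRep.t2Space {E X Y : Type*} [TopologicalSpace E] [TopologicalSpace X]
    [TopologicalSpace Y] [T2Space Y] {φ : E → X → Y} (h : IsKRep φ) : T2Space E :=
  T2Space.of_injective_continuous h.injective (continuous_pi h.continuous_apply)

/-- The image of `K` is compact, so some open `V` contains it with `closure V ⊆ U`. Testing at
single points shows that the closure of `[K; V]` lies in `[K; closure V]`. -/
theorem IsKRep.regularSpace {E X Y : Type*} [TopologicalSpace E] [TopologicalSpace X]
    [TopologicalSpace Y] [RegularSpace Y] {φ : E → X → Y} (h : IsKRep φ) : RegularSpace E := by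
  refine .of_lift'_closure_le fun e => h.le_nhds _ _ fun K U hK hU he => ?_
  obtain ⟨V, hVo, hKV, hVU⟩ := (hK.image_of_continuousOn
    (h.continuousOn e K hK)).exists_isOpen_closure_subset (hU.mem_nhdsSet.2 he.image_subset)
  refine mem_of_superset (mem_lift' (h.eventually e K V hK hVo (mapsTo_iff_image_subset.2 hKV))) ?_
  intro f hf x hx
  refine hVU (by_contra fun hfx => ?_)
  have h1 := h.eventually f {x} (closure V)ᶜ isCompact_singleton isClosed_closure.isOpen_compl
    (by simpa using hfx)
  obtain ⟨g, hg1, hg2⟩ := mem_closure_iff_nhds.1 hf _ h1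
  exact hg1 rfl (subset_closure (hg2 hx))

/-! ### Products and sums. -/

/-- A tuple of maps is one index-preserving map between sums. A compact subset of a sum meets
finitely many summands, which matches the product topology. -/
theorem isKRep_pi {ι : Type*} {E X Y : ι → Type*} [∀ i, TopologicalSpace (E i)]
    [∀ i, TopologicalSpace (X i)] [∀ i, TopologicalSpace (Y i)] {φ : ∀ i, E i → X i → Y i}
    (h : ∀ i, IsKRep (φ i)) :
    IsKRep fun (e : ∀ i, E i) (z : Σ i, X i) => (⟨z.1, φ z.1 (e z.1) z.2⟩ : Σ i, Y i) := by
  refine ⟨fun e f hef => funext fun i => (h i).injective (funext fun x => ?_), ?_, ?_, ?_⟩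
  · simpa using congrFun hef ⟨i, x⟩
  · rintro e K hK ⟨i, x⟩ hx
    have h1 : Tendsto (fun x => (⟨i, φ i (e i) x⟩ : Σ i, Y i)) (𝓝[Sigma.mk i ⁻¹' K] x)
        (𝓝 ⟨i, φ i (e i) x⟩) :=
      continuous_sigmaMk.continuousAt.tendsto.comp
        ((h i).continuousOn (e i) _ (hK.preimage_sigmaMk i) x hx)
    have h2 : 𝓝[K] (⟨i, x⟩ : Σ i, X i) = map (Sigma.mk i) (𝓝[Sigma.mk i ⁻¹' K] x) := by
      rw [IsOpenEmbedding.sigmaMk.map_nhdsWithin_preimage_eq]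
    rw [ContinuousWithinAt, h2, tendsto_map'_iff]
    exact h1
  · intro e K U hK hU he
    obtain ⟨t, ht⟩ := hK.exists_finite_sigma
    have h1 : ∀ i, ∀ᶠ e' in 𝓝 e, MapsTo (φ i (e' i)) (Sigma.mk i ⁻¹' K) (Sigma.mk i ⁻¹' U) :=
      fun i => (continuous_apply i).continuousAt.eventually
        ((h i).eventually (e i) _ _ (hK.preimage_sigmaMk i) (hU.preimage continuous_sigmaMk)
          fun x hx => he hx)
    filter_upwards [(eventually_all_finset t).2 fun i _ => h1 i]
    rintro e' he' ⟨i, x⟩ hx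
    exact he' i (ht _ hx) hx
  · intro e l hl
    refine tendsto_pi_nhds.2 fun i => ?_
    refine (h i).le_nhds (e i) (map _ l) fun K U hK hU he => ?_
    rw [eventually_map]
    filter_upwards [hl (Sigma.mk i '' K) (Sigma.mk i '' U) (hK.image continuous_sigmaMk)
      (isOpenMap_sigmaMk U hU) (by rintro _ ⟨x, hx, rfl⟩; exact ⟨_, he hx, rfl⟩)]
      with e' he' x hx
    simpa using he' (mem_image_of_mem (Sigma.mk i) hx)

theorem kClass_pi {p : Prop} {ι : Type} [Countable ι] {E : ι → Type u}
    [∀ i, TopologicalSpace (E i)] (h : ∀ i, kClass p (E i)) : kClass p (∀ i, E i) := by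
  choose X Y tX tY φ h1 h2 h3 h4 h5 using h
  exact ⟨Σ i, X i, Σ i, Y i, inferInstance, inferInstance, _, inferInstance, .sigma h2,
    metrizableSpace_sigma, fun hp => by have := fun i => h4 i hp; infer_instance, isKRep_pi h5⟩

section Sigma

variable {ι : Type} {E X Y : ι → Type u}

open Classical in
/-- The representation of a topological sum: the value at the extra point records the index. -/
noncomputable def sigmaRep (φ : ∀ i, E i → X i → Y i) (z : Σ i, E i) :
    PUnit.{u + 1} ⊕ (Σ i, X i) → ULift.{u} ι ⊕ Σ i, Y i
  | Sum.inl _ => Sum.inl ⟨z.1⟩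
  | Sum.inr w => if h : z.1 = w.1 then Sum.inr ⟨w.1, φ w.1 (h ▸ z.2) w.2⟩ else Sum.inl ⟨z.1⟩

theorem sigmaRep_inl (φ : ∀ i, E i → X i → Y i) (i : ι) (e : E i) (x : PUnit.{u + 1}) :
    sigmaRep φ ⟨i, e⟩ (Sum.inl x) = Sum.inl ⟨i⟩ := rfl

theorem sigmaRep_inr_self (φ : ∀ i, E i → X i → Y i) (i : ι) (e : E i) (x : X i) :
    sigmaRep φ ⟨i, e⟩ (Sum.inr ⟨i, x⟩) = Sum.inr ⟨i, φ i e x⟩ := by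
  simp [sigmaRep]

theorem sigmaRep_inr_of_ne (φ : ∀ i, E i → X i → Y i) {i j : ι} (hij : i ≠ j) (e : E i)
    (x : X j) : sigmaRep φ ⟨i, e⟩ (Sum.inr ⟨j, x⟩) = Sum.inl ⟨i⟩ := by
  simp [sigmaRep, hij]

variable [∀ i, TopologicalSpace (E i)] [∀ i, TopologicalSpace (X i)]
  [∀ i, TopologicalSpace (Y i)] [TopologicalSpace ι] [DiscreteTopology ι]

theorem isKRep_sigma {φ : ∀ i, E i → X i → Y i} (h : ∀ i, IsKRep (φ i)) :
    IsKRep (sigmaRep φ) := by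
  refine ⟨?_, ?_, ?_, ?_⟩
  · rintro ⟨i, e⟩ ⟨j, f⟩ hef
    obtain rfl : i = j := by simpa [sigmaRep_inl] using congrFun hef (Sum.inl ⟨⟩)
    refine congrArg _ ((h i).injective (funext fun x => ?_))
    simpa [sigmaRep_inr_self] using congrFun hef (Sum.inr ⟨i, x⟩)
  · rintro ⟨i, e⟩ K hK (x | ⟨j, x⟩) hx
    · refine ContinuousAt.continuousWithinAt ?_
      rw [ContinuousAt, nhds_inl, tendsto_map'_iff]
      exact tendsto_const_nhds
    · have hK' : IsCompact (Sigma.mk j ⁻¹' (Sum.inr ⁻¹' K)) :=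
        (IsClosedEmbedding.inr.isCompact_preimage hK).preimage_sigmaMk j
      have h2 : 𝓝[K] (Sum.inr ⟨j, x⟩ : PUnit.{u + 1} ⊕ Σ i, X i) =
          map (Sum.inr ∘ Sigma.mk j) (𝓝[Sigma.mk j ⁻¹' (Sum.inr ⁻¹' K)] x) := by
        rw [← preimage_comp, (IsOpenEmbedding.inr.comp
          IsOpenEmbedding.sigmaMk).map_nhdsWithin_preimage_eq]
        rfl
      rw [ContinuousWithinAt, h2, tendsto_map'_iff]
      by_cases hij : i = j
      · subst hij
        have h3 : sigmaRep φ ⟨i, e⟩ ∘ Sum.inr ∘ Sigma.mk i =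
            Sum.inr ∘ Sigma.mk i ∘ φ i e := funext fun x => sigmaRep_inr_self φ i e x
        rw [h3, sigmaRep_inr_self]
        exact ((continuous_inr.comp continuous_sigmaMk).continuousAt.tendsto.comp
          ((h i).continuousOn e _ hK' x hx))
      · have h3 : sigmaRep φ ⟨i, e⟩ ∘ Sum.inr ∘ Sigma.mk j = fun _ => Sum.inl ⟨i⟩ :=
          funext fun x => sigmaRep_inr_of_ne φ hij e x
        rw [h3, sigmaRep_inr_of_ne φ hij]
        exact tendsto_const_nhds
  · rintro ⟨i, e⟩ K U hK hU he
    rw [Sigma.nhds_mk, eventually_map]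
    have hK' : IsCompact (Sigma.mk i ⁻¹' (Sum.inr ⁻¹' K)) :=
      (IsClosedEmbedding.inr.isCompact_preimage hK).preimage_sigmaMk i
    filter_upwards [(h i).eventually e _ (Sigma.mk i ⁻¹' (Sum.inr ⁻¹' U)) hK'
      ((hU.preimage continuous_inr).preimage continuous_sigmaMk) fun x hx => by
        simpa [sigmaRep_inr_self] using he hx]
    rintro e' he' (x | ⟨j, x⟩) hx
    · exact he hx
    · by_cases hij : i = j
      · subst hij
        rw [sigmaRep_inr_self]
        exact he' hx
      · have := he hx
        rw [sigmaRep_inr_of_ne φ hij] at this ⊢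
        exact this
  · rintro ⟨i, e⟩ l hl
    -- The condition at the extra point alone forces the index to be `i`, so the filter lives on one
    -- summand.
    have h1 : ∀ᶠ z in l, z ∈ range (Sigma.mk (β := E) i) := by
      filter_upwards [hl {Sum.inl ⟨⟩} {Sum.inl ⟨i⟩} isCompact_singleton
        (by rw [← image_singleton]; exact isOpenMap_inl _ (isOpen_discrete _))
        (by simp [sigmaRep_inl])]
      rintro ⟨j, f⟩ hf
      obtain rfl : j = i := by simpa [sigmaRep_inl] using hf rfl
      exact ⟨f, rfl⟩
    rw [Sigma.nhds_mk, ← map_comap_of_mem (f := l) h1]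
    refine map_mono ((h i).le_nhds e _ fun K U hK hU he => ?_)
    have h2 := hl (Sum.inr '' (Sigma.mk i '' K)) (Sum.inr '' (Sigma.mk i '' U))
      ((hK.image continuous_sigmaMk).image continuous_inr)
      (isOpenMap_inr _ (isOpenMap_sigmaMk U hU)) (by
        rintro _ ⟨_, ⟨x, hx, rfl⟩, rfl⟩
        rw [sigmaRep_inr_self]
        exact ⟨_, ⟨_, he hx, rfl⟩, rfl⟩)
    filter_upwards [preimage_mem_comap h2] with f hf x hx
    have h3 : sigmaRep φ ⟨i, f⟩ (Sum.inr ⟨i, x⟩) ∈ _ :=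
      hf (mem_image_of_mem _ (mem_image_of_mem _ hx))
    rw [sigmaRep_inr_self] at h3
    simpa using h3

end Sigma

theorem kClass_sigma {p : Prop} {ι : Type} [Countable ι] {E : ι → Type u}
    [∀ i, TopologicalSpace (E i)] (h : ∀ i, kClass p (E i)) : kClass p (Σ i, E i) := by
  choose X Y tX tY φ h1 h2 h3 h4 h5 using h
  let _ : TopologicalSpace ι := ⊥
  have : DiscreteTopology ι := ⟨rfl⟩
  have := metrizableSpace_sigma (Y := Y)
  exact ⟨_, _, inferInstance, inferInstance, sigmaRep φ, inferInstance, .sum .punit (.sigma h2),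
    metrizableSpace_sum, fun hp => by have := fun i => h4 i hp; infer_instance, isKRep_sigma h5⟩

/-! ### Function spaces. -/

section FunctionSpace

variable {Z E X Y : Type*} [TopologicalSpace Z] [TopologicalSpace E] [TopologicalSpace X]
  [TopologicalSpace Y] [T2Space X] {φ : E → X → Y}

/-- Continuity of `φ (g z)` on `L` gives a compact relative neighborhood `L'` of `x` sent into `U`;
then `[L'; U]` is a neighborhood of `g z`, and continuity of `g` controls the first variable. -/
theorem IsKRep.continuousOn_uncurry (h : IsKRep φ) (g : C(Z, E)) {K : Set Z} {L : Set X}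
    (hL : IsCompact L) : ContinuousOn (fun z : Z × X => φ (g z.1) z.2) (K ×ˢ L) := by
  rintro ⟨z, x⟩ ⟨hz, hx⟩
  refine (nhds_basis_opens _).ge_iff.2 fun U hU => ?_
  obtain ⟨L', hL', hLU, hLc⟩ := hL.exists_isCompact_mem_nhdsWithin hx
    (h.continuousOn (g z) L hL x hx (hU.2.mem_nhds hU.1))
  have h1 : ∀ᶠ z' in 𝓝[K] z, MapsTo (φ (g z')) L' U :=
    nhdsWithin_le_nhds (g.continuous.continuousAt.eventually (h.eventually (g z) L' U hLc hU.2 hLU))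
  rw [nhdsWithin_prod_eq]
  refine mem_map.2 (mem_of_superset (prod_mem_prod h1 hL') ?_)
  rintro ⟨z', x'⟩ ⟨h2, h3⟩
  exact h2 h3

/-- This is the exponential law. Covering a compact set by finitely many compact boxes `V × W`
reduces `[C; U]` to conditions `[V; [W; U]]`. -/
theorem isKRep_continuousMap [T2Space Z] (h : IsKRep φ) :
    IsKRep fun (g : C(Z, E)) (z : Z × X) => φ (g z.1) z.2 := by
  refine ⟨fun f g hfg => ContinuousMap.ext fun z => h.injective (funext fun x =>
    congrFun hfg (z, x)), fun g C hC => ?_, fun g C U hC hU hg => ?_, fun g l hl => ?_⟩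
  · exact (h.continuousOn_uncurry g (K := Prod.fst '' C) (hC.image continuous_snd)).mono
      fun c hc => ⟨⟨c, hc, rfl⟩, ⟨c, hc, rfl⟩⟩
  · obtain ⟨t, htf, htc, htC, htU⟩ := hC.exists_finite_boxes
      (P := (fun z : Z × X => φ (g z.1) z.2) ⁻¹' U) fun c hc =>
        h.continuousOn_uncurry g (K := Prod.fst '' C) (hC.image continuous_snd) c
          ⟨⟨c, hc, rfl⟩, ⟨c, hc, rfl⟩⟩ (hU.mem_nhds (hg hc))
    have h1 : ∀ q ∈ t, ∀ᶠ g' : C(Z, E) in 𝓝 g, ∀ z ∈ q.1, MapsTo (φ (g' z)) q.2 U := by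
      intro q hq
      have ho : IsOpen {e | MapsTo (φ e) q.2 U} := isOpen_iff_mem_nhds.2 fun e he =>
        h.eventually e q.2 U (htc q hq).2 hU he
      exact ContinuousMap.eventually_mapsTo (htc q hq).1 ho
        fun z hz x hx => htU q hq (show (z, x) ∈ q.1 ×ˢ q.2 from ⟨hz, hx⟩)
    filter_upwards [(eventually_all_finite htf).2 h1] with g' hg' c hc
    obtain ⟨q, hq, hcq⟩ := htC c hc
    exact hg' q hq _ hcq.1 hcq.2
  · change Tendsto id l (𝓝 g)
    refine ContinuousMap.tendsto_nhds_compactOpen.2 fun K hK W hW hg => ?_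
    have h1 : ∀ z ∈ K, ∃ K' ∈ 𝓝[K] z, ∀ᶠ g' in l, MapsTo (g' : C(Z, E)) K' W := fun z hz => by
      -- Evaluation converges jointly in the map and the point of `K`; this local statement is then
      -- made uniform on `K` by compactness.
      have h2 : map (fun p : C(Z, E) × Z => p.1 p.2) (l ×ˢ 𝓝[K] z) ≤ 𝓝 (g z) := by
        refine h.le_nhds _ _ fun L U hL hU hgL => ?_
        obtain ⟨K', hK', hKU, hKc⟩ := hK.exists_isCompact_mem_nhdsWithin hz
          (nhdsWithin_le_nhds (g.continuous.continuousAt.eventually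
            (h.eventually (g z) L U hL hU hgL)))
        have h3 := hl (K' ×ˢ L) U (hKc.prod hL) hU fun c hc => hKU hc.1 hc.2
        rw [eventually_map]
        filter_upwards [prod_mem_prod h3 hK'] with p hp x hx
        exact hp.1 (show (p.2, x) ∈ K' ×ˢ L from ⟨hp.2, hx⟩)
      obtain ⟨A, hA, K', hK', hAK⟩ := mem_prod_iff.1 (mem_map.1 (h2 (hW.mem_nhds (hg hz))))
      exact ⟨K', hK', mem_of_superset hA fun g' hg' z' hz' =>
        hAK (show (g', z') ∈ A ×ˢ K' from ⟨hg', hz'⟩)⟩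
    choose! K' hK' hl' using h1
    obtain ⟨t, htK, ht⟩ := hK.elim_nhdsWithin_subcover K' hK'
    filter_upwards [(eventually_all_finset t).2 fun z hz => hl' z (htK z hz)] with g' hg' z hz
    obtain ⟨w, hw, hzw⟩ := mem_iUnion₂.1 (ht hz)
    exact hg' w hw hzw

end FunctionSpace

/-! ### The `cp`-network of a represented space. -/

theorem IsCompact.union_range {X ι : Type*} [TopologicalSpace X] {K : Set X} (hK : IsCompact K)
    {x : ι → X} (h : ∀ U, IsOpen U → K ⊆ U → {i | x i ∉ U}.Finite) :
    IsCompact (K ∪ range x) := by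
  classical
  refine isCompact_of_finite_subcover fun {κ} U ho hc => ?_
  obtain ⟨t, ht⟩ := hK.elim_finite_subcover U ho (subset_union_left.trans hc)
  have hfin := (h _ (isOpen_biUnion fun i _ => ho i) ht).image x
  obtain ⟨t', ht'⟩ := hfin.isCompact.elim_finite_subcover U ho
    (((image_subset_range _ _).trans subset_union_right).trans hc)
  refine ⟨t ∪ t', ?_⟩
  rw [Finset.set_biUnion_union]
  refine union_subset (ht.trans subset_union_left) ?_
  rintro _ ⟨i, rfl⟩
  by_cases hi : x i ∈ ⋃ j ∈ t, U j
  · exact Or.inl hi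
  · exact Or.inr (ht' ⟨i, hi, rfl⟩)

theorem HasCountableKNetwork.exists_inter_mem {X : Type u} [TopologicalSpace X]
    (h : HasCountableKNetwork X) :
    ∃ 𝒩 : Set (Set X), 𝒩.Countable ∧ (∀ A ∈ 𝒩, ∀ B ∈ 𝒩, A ∩ B ∈ 𝒩) ∧
      ∀ K U, IsCompact K → IsOpen U → K ⊆ U → ∃ N ∈ 𝒩, K ⊆ N ∧ N ⊆ U := by
  obtain ⟨𝒩, hc, h⟩ := h
  refine ⟨finiteInters 𝒩, finiteInters_countable hc, ?_, fun K U hK hU hKU => ?_⟩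
  · rintro _ ⟨s, hs, hsN, rfl⟩ _ ⟨t, ht, htN, rfl⟩
    exact ⟨s ∪ t, hs.union ht, union_subset hsN htN, (sInter_union s t).symm⟩
  · obtain ⟨N, hN, h1⟩ := h K U hK hU hKU
    exact ⟨N, ⟨{N}, finite_singleton N, singleton_subset_iff.2 hN, (sInter_singleton N).symm⟩, h1⟩

/-- A decreasing sequence of sets converges to a compact set `K`. -/
structure ShrinksTo {X : Type*} [TopologicalSpace X] (N : ℕ → Set X) (K : Set X) : Prop where
  antitone : Antitone N
  subset : ∀ n, K ⊆ N n
  exists_subset : ∀ U, IsOpen U → K ⊆ U → ∃ n, N n ⊆ U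

theorem exists_shrinksTo {X : Type*} [TopologicalSpace X] {𝒩 : Set (Set X)} (hc : 𝒩.Countable)
    (hi : ∀ A ∈ 𝒩, ∀ B ∈ 𝒩, A ∩ B ∈ 𝒩) {K : Set X}
    (h : ∀ U, IsOpen U → K ⊆ U → ∃ N ∈ 𝒩, K ⊆ N ∧ N ⊆ U) :
    ∃ N : ℕ → Set X, (∀ n, N n ∈ 𝒩) ∧ ShrinksTo N K := by
  obtain ⟨N₀, hN₀, hKN₀, -⟩ := h univ isOpen_univ (subset_univ K)
  have hc' : {N ∈ 𝒩 | K ⊆ N}.Countable := hc.mono fun N hN => hN.1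
  obtain ⟨f, hf⟩ := hc'.exists_eq_range ⟨N₀, hN₀, hKN₀⟩
  have hf' : ∀ n, f n ∈ {N ∈ 𝒩 | K ⊆ N} := fun n => hf ▸ mem_range_self n
  let N : ℕ → Set X := fun n => Nat.rec (f 0) (fun n A => A ∩ f (n + 1)) n
  have hs : ∀ n, N (n + 1) = N n ∩ f (n + 1) := fun n => rfl
  have hN : ∀ n, N n ∈ {N ∈ 𝒩 | K ⊆ N} := fun n => by
    induction n with
    | zero => exact hf' 0
    | succ n ih => rw [hs]; exact ⟨hi _ ih.1 _ (hf' _).1, subset_inter ih.2 (hf' _).2⟩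
  refine ⟨N, fun n => (hN n).1, antitone_nat_of_succ_le fun n => inter_subset_left,
    fun n => (hN n).2, fun U hU hKU => ?_⟩
  obtain ⟨M, hM, hKM, hMU⟩ := h U hU hKU
  obtain ⟨n, rfl⟩ : M ∈ range f := hf ▸ ⟨hM, hKM⟩
  refine ⟨n, Subset.trans ?_ hMU⟩
  cases n with
  | zero => exact Subset.rfl
  | succ n => exact inter_subset_right

theorem ShrinksTo.isCompact_union_range {X ι : Type*} [TopologicalSpace X] {N : ℕ → Set X}
    {K : Set X} (h : ShrinksTo N K) (hK : IsCompact K) {x : ι → X} {m : ι → ℕ}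
    (hx : ∀ i, x i ∈ N (m i)) (hm : ∀ n, {i | m i < n}.Finite) : IsCompact (K ∪ range x) := by
  refine hK.union_range fun U hU hKU => ?_
  obtain ⟨n, hn⟩ := h.exists_subset U hU hKU
  exact (hm n).subset fun i hi => lt_of_not_ge fun hle => hi (hn (h.antitone hle (hx i)))

/-- Otherwise points of `N n` sent outside `B` would form, together with `K`, a compact set on which
`f` is continuous. A neighborhood of `K` in that set is sent into `B`, yet it contains one of those
points. -/
theorem ShrinksTo.exists_mapsTo {X Y : Type*} [TopologicalSpace X] [TopologicalSpace Y]
    {N : ℕ → Set X} {K : Set X} (h : ShrinksTo N K) (hK : IsCompact K) {f : X → Y}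
    (hf : ∀ L, IsCompact L → ContinuousOn f L) {B : Set Y} (hB : IsOpen B) (hKB : MapsTo f K B) :
    ∃ n, MapsTo f (N n) B := by
  by_contra! hne
  have h1 : ∀ n, ∃ x ∈ N n, f x ∉ B := fun n => by
    simpa [MapsTo] using hne n
  choose x hxN hxB using h1
  have hL := h.isCompact_union_range hK hxN fun n => finite_Iio n
  obtain ⟨U, hU, hUB⟩ := continuousOn_iff'.1 (hf _ hL) B hB
  have hKU : K ⊆ U := fun y hy => (hUB.subset ⟨hKB hy, Or.inl hy⟩).1
  obtain ⟨n, hn⟩ := h.exists_subset U hU hKU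
  exact hxB n (hUB.superset ⟨hn (hxN n), Or.inr ⟨n, rfl⟩⟩).1

section CpNetwork

variable {E X Y : Type u} [TopologicalSpace E] [TopologicalSpace X] [TopologicalSpace Y]
  {φ : E → X → Y}

theorem IsKRep.exists_finite_subset [T2Space X] (h : IsKRep φ) {ℬ : Set (Set Y)}
    (hB : ∀ y, ∀ U ∈ 𝓝 y, ∃ B ∈ ℬ, y ∈ B ∧ B ⊆ U) (hBo : ∀ B ∈ ℬ, IsOpen B) {e : E} {O : Set E}
    (hO : O ∈ 𝓝 e) : ∃ s : Set (Set X × Set Y), s.Finite ∧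
      (∀ q ∈ s, IsCompact q.1 ∧ q.2 ∈ ℬ ∧ MapsTo (φ e) q.1 q.2) ∧
      {e' | ∀ q ∈ s, MapsTo (φ e') q.1 q.2} ⊆ O := by
  -- The sets satisfying the conclusion form a filter, so it is enough to compare this filter with
  -- `𝓝 e` through `le_nhds`.
  let l : Filter E :=
    { sets := {O | ∃ s : Set (Set X × Set Y), s.Finite ∧
        (∀ q ∈ s, IsCompact q.1 ∧ q.2 ∈ ℬ ∧ MapsTo (φ e) q.1 q.2) ∧
        {e' | ∀ q ∈ s, MapsTo (φ e') q.1 q.2} ⊆ O}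
      univ_sets := ⟨∅, finite_empty, by simp, subset_univ _⟩
      sets_of_superset := fun ⟨s, h1, h2, h3⟩ hxy => ⟨s, h1, h2, h3.trans hxy⟩
      inter_sets := fun ⟨s, h1, h2, h3⟩ ⟨t, h1', h2', h3'⟩ =>
        ⟨s ∪ t, h1.union h1', fun q hq => hq.elim (h2 q) (h2' q), fun e' he' =>
          ⟨h3 fun q hq => he' q (Or.inl hq), h3' fun q hq => he' q (Or.inr hq)⟩⟩ }
  refine h.le_nhds e l (fun K U hK hU he => ?_) hO
  have h1 : ∀ x ∈ K, ∃ q : Set X × Set Y, q.1 ∈ 𝓝[K] x ∧ IsCompact q.1 ∧ q.2 ∈ ℬ ∧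
      MapsTo (φ e) q.1 q.2 ∧ q.2 ⊆ U := fun x hx => by
    obtain ⟨B, hBB, hxB, hBU⟩ := hB _ U (hU.mem_nhds (he hx))
    obtain ⟨K', hK', hKB, hKc⟩ := hK.exists_isCompact_mem_nhdsWithin hx
      (h.continuousOn e K hK x hx ((hBo B hBB).mem_nhds hxB))
    exact ⟨(K', B), hK', hKc, hBB, hKB, hBU⟩
  choose! q hq1 hq2 hq3 hq4 hq5 using h1
  obtain ⟨t, htK, ht⟩ := hK.elim_nhdsWithin_subcover (fun x => (q x).1) hq1
  refine ⟨q '' t, t.finite_toSet.image q, ?_, fun e' he' x hx => ?_⟩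
  · rintro _ ⟨x, hx, rfl⟩
    exact ⟨hq2 x (htK x hx), hq3 x (htK x hx), hq4 x (htK x hx)⟩
  · obtain ⟨y, hy, hxy⟩ := mem_iUnion₂.1 (ht hx)
    exact hq5 y (htK y hy) (he' _ ⟨y, hy, rfl⟩ hxy)

/-- The sets of maps that send a member of `𝒩` into a member of `ℬ`. -/
def mapsToFamily (φ : E → X → Y) (𝒩 : Set (Set X)) (ℬ : Set (Set Y)) : Set (Set E) :=
  image2 (fun N B => {e | MapsTo (φ e) N B}) 𝒩 ℬ

theorem IsKRep.isCpNetwork [T2Space X] [T1Space E] (h : IsKRep φ) {𝒩 : Set (Set X)}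
    (hc : 𝒩.Countable) (hi : ∀ A ∈ 𝒩, ∀ B ∈ 𝒩, A ∩ B ∈ 𝒩)
    (hN : ∀ K U, IsCompact K → IsOpen U → K ⊆ U → ∃ N ∈ 𝒩, K ⊆ N ∧ N ⊆ U) {ℬ : Set (Set Y)}
    (hB : ∀ y, ∀ U ∈ 𝓝 y, ∃ B ∈ ℬ, y ∈ B ∧ B ⊆ U) (hBo : ∀ B ∈ ℬ, IsOpen B) :
    IsCpNetwork (finiteInters (mapsToFamily φ 𝒩 ℬ)) := by
  intro f O hO A _
  obtain ⟨s, hs, hsK, hsO⟩ := h.exists_finite_subset hB hBo hO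
  have h1 : ∀ q ∈ s, ∃ N : ℕ → Set X, (∀ n, N n ∈ 𝒩) ∧ ShrinksTo N q.1 := fun q hq =>
    exists_shrinksTo hc hi fun U hU hKU => hN _ U (hsK q hq).1 hU hKU
  choose! N hNN hNK using h1
  let F : ℕ → Set E := fun m => {e | ∀ q ∈ s, MapsTo (φ e) (N q m) q.2}
  have hFmem : ∀ m, F m ∈ finiteInters (mapsToFamily φ 𝒩 ℬ) := fun m => by
    refine ⟨(fun q => {e | MapsTo (φ e) (N q m) q.2}) '' s, hs.image _, ?_, ?_⟩
    · rintro _ ⟨q, hq, rfl⟩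
      exact mem_image2_of_mem (hNN q hq m) (hsK q hq).2.1
    · ext e
      simp [F]
  have hFmono : ∀ m n, m ≤ n → F m ⊆ F n := fun m n hmn e he q hq =>
    (he q hq).mono_left ((hNK q hq).antitone hmn)
  have hFO : ∀ m, F m ⊆ O := fun m e he =>
    hsO fun q hq => (he q hq).mono_left ((hNK q hq).subset m)
  have hF : ∀ e, (∀ q ∈ s, MapsTo (φ e) q.1 q.2) → ∃ m, e ∈ F m := fun e he => by
    have h2 : ∀ q ∈ s, ∃ n, MapsTo (φ e) (N q n) q.2 := fun q hq =>
      (hNK q hq).exists_mapsTo (hsK q hq).1 (h.continuousOn e) (hBo _ (hsK q hq).2.1) (he q hq)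
    choose! n hn using h2
    obtain ⟨b, hb⟩ := (hs.image n).bddAbove
    exact ⟨b, fun q hq => (hn q hq).mono_left ((hNK q hq).antitone (hb ⟨q, hq, rfl⟩))⟩
  obtain ⟨m₀, hm₀⟩ := hF f fun q hq => (hsK q hq).2.2
  by_contra! hcon
  have hacc : AccPt f (𝓟 A) := (hcon _ (hFmem m₀) hm₀ (hFO m₀)).1
  -- The negated conclusion concerns only those `F n` known to contain `f`, hence the passage to
  -- `max m m₀`.
  have hfin : ∀ m, (F m ∩ A).Finite := fun m => by
    have h2 := (hcon _ (hFmem (max m m₀)) (hFmono _ _ (le_max_right _ _) hm₀) (hFO _)).2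
    exact h2.subset (inter_subset_inter_left _ (hFmono _ _ (le_max_left _ _)))
  let D : Set E := {a ∈ A | (∀ q ∈ s, MapsTo (φ a) q.1 q.2) ∧ a ∉ F m₀}
  have h3 : ∀ a : D, ∃ m, ∃ q ∈ s, ∃ x, m₀ ≤ m ∧ (a : E) ∈ F (m + 1) ∧ x ∈ N q m ∧
      φ a x ∉ q.2 := by
    classical
    rintro ⟨a, haA, haW, ha⟩
    -- The first stage containing `a` comes after `m₀`. Its predecessor `m ≥ m₀` supplies a point
    -- that `a` sends outside `q.2`, whereas `f` already behaves well at stage `m`.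
    have hk := Nat.find_spec (hF a haW)
    have hk' : m₀ < Nat.find (hF a haW) := lt_of_not_ge fun hle => ha (hFmono _ _ hle hk)
    obtain ⟨m, hm⟩ : ∃ m, Nat.find (hF a haW) = m + 1 := ⟨_, (Nat.sub_add_cancel (by lia)).symm⟩
    have hmF : a ∉ F m := Nat.find_min (hF a haW) (by lia)
    rw [hm] at hk hk'
    have hex : ∃ q ∈ s, ∃ x ∈ N q m, φ a x ∉ q.2 := by simpa [F, MapsTo] using hmF
    obtain ⟨q, hq, x, hx, hxq⟩ := hex
    exact ⟨m, q, hq, x, by lia, hk, hx, hxq⟩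
  choose m q hq x hm hmF hx hxq using h3
  have hmfin : ∀ n, {a : D | m a < n}.Finite := fun n => by
    refine Finite.of_finite_image ((hfin n).subset ?_) Subtype.val_injective.injOn
    rintro _ ⟨a, ha, rfl⟩
    exact ⟨hFmono _ _ (Nat.succ_le_of_lt ha) (hmF a), a.2.1⟩
  -- Only finitely many `a` fail before a given stage, so the witnesses attached to `r` converge to
  -- `r.1`, and `K' r` is compact.
  let K' : Set X × Set Y → Set X := fun r => r.1 ∪ range fun a : {a : D // q a = r} => x a
  have hK' : ∀ r ∈ s, ∀ᶠ e in 𝓝 f, MapsTo (φ e) (K' r) r.2 := fun r hr => by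
    refine h.eventually f _ _ ?_ (hBo _ (hsK r hr).2.1) ?_
    · refine (hNK r hr).isCompact_union_range (hsK r hr).1 (m := fun a => m a.1) ?_ fun n => ?_
      · rintro ⟨a, rfl⟩
        exact hx a
      · exact (hmfin n).preimage Subtype.val_injective.injOn
    · rintro y (hy | ⟨⟨a, rfl⟩, rfl⟩)
      · exact (hsK r hr).2.2 hy
      · exact hm₀ _ hr ((hNK _ hr).antitone (hm a) (hx a))
  -- The neighborhood defined by the `K' r` excludes every element of `D`, so it meets `A` inside
  -- the finite set `F m₀ ∩ A`.
  have hG := hacc.nhds_inter ((eventually_all_finite hs).2 hK')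
  refine Set.Infinite.of_accPt hG ((hfin m₀).subset ?_)
  rintro a ⟨haG, haA⟩
  refine ⟨by_contra fun ha => ?_, haA⟩
  have haD : a ∈ D := ⟨haA, fun r hr => (haG r hr).mono_left subset_union_left, ha⟩
  exact hxq ⟨a, haD⟩ (haG _ (hq ⟨a, haD⟩) (Or.inr ⟨⟨⟨a, haD⟩, rfl⟩, rfl⟩))

/-- Evaluation at one point of `N` pulls the locally finite family back to an open expansion. For
empty `N` the family has at most one member. -/
theorem IsKRep.hasOpenExpansion (h : IsKRep φ) (N : Set X) {ℬ : Set (Set Y)}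
    (hBo : ∀ B ∈ ℬ, IsOpen B) (hl : LocallyFinite fun B : ℬ => (B : Set Y)) :
    HasOpenExpansion (mapsToFamily φ {N} ℬ) := by
  rw [mapsToFamily, image2_singleton_left]
  rcases N.eq_empty_or_nonempty with rfl | ⟨x, hx⟩
  · refine (HasOpenExpansion.singleton univ).mono ?_
    rintro _ ⟨B, -, rfl⟩
    exact eq_univ_of_forall fun e => mapsTo_empty _ _
  · rw [image_eq_range]
    exact .of_index (fun B : ℬ => (hBo B B.2).preimage (h.continuous_apply x))
      (fun B e he => he hx) (hl.preimage_continuous (h.continuous_apply x))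

theorem IsKRep.hasSigmaOpenExpansion (h : IsKRep φ) {𝒩 : Set (Set X)} (hc : 𝒩.Countable)
    {ℬ : ℕ → Set (Set Y)} (hBo : ∀ n, ∀ B ∈ ℬ n, IsOpen B)
    (hl : ∀ n, LocallyFinite fun B : ℬ n => (B : Set Y)) :
    HasSigmaOpenExpansion (mapsToFamily φ 𝒩 (⋃ n, ℬ n)) := by
  have := hc.to_subtype
  have h1 : mapsToFamily φ 𝒩 (⋃ n, ℬ n) = ⋃ p : 𝒩 × ℕ, mapsToFamily φ {p.1.1} (ℬ p.2) := by
    ext A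
    simp only [mapsToFamily, mem_image2, mem_iUnion, Prod.exists, Subtype.exists,
      mem_singleton_iff]
    grind
  rw [h1]
  exact .of_countable fun p => h.hasOpenExpansion _ (hBo _) (hl _)

end CpNetwork

/-! ### Stability of the class and conclusion. -/

theorem kClass.exists_isCpNetwork {p : Prop} {E : Type u} [TopologicalSpace E]
    (h : kClass p E) : T3Space E ∧
      ∃ 𝒟 : Set (Set E), IsCpNetwork 𝒟 ∧ HasSigmaOpenExpansion 𝒟 ∧ (p → 𝒟.Countable) := by
  obtain ⟨X, Y, _, _, φ, _, h2, _, h4, hφ⟩ := h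
  have := hφ.t2Space
  have := hφ.regularSpace
  obtain ⟨𝒩, hc, hi, hN⟩ := h2.exists_inter_mem
  obtain ⟨ℬ, hBo, hl, hB⟩ := exists_sigma_locallyFinite_base Y
  refine ⟨inferInstance, finiteInters (mapsToFamily φ 𝒩 (⋃ n, ℬ n)), ?_,
    (hφ.hasSigmaOpenExpansion hc hBo hl).finiteInters, fun hp => ?_⟩
  · refine hφ.isCpNetwork hc hi hN (fun y U hU => ?_) fun B hB => ?_
    · obtain ⟨n, B, h1, h2⟩ := hB y U hU
      exact ⟨B, mem_iUnion.2 ⟨n, h1⟩, h2⟩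
    · obtain ⟨n, hn⟩ := mem_iUnion.1 hB
      exact hBo n B hn
  · have := h4 hp
    exact finiteInters_countable (hc.image2 (IsSigmaLocallyFinite.countable ⟨ℬ, rfl, hl⟩) _)

theorem isCkStable_kClass (p : Prop) : (kClass.{u} p).IsCkStable where
  subspace _ _ _ h := kClass_of_isEmbedding .subtypeVal h
  homeomorph _ _ _ _ e h := kClass_of_isEmbedding e.symm.isEmbedding h
  sum _ _ _ _ h := kClass_sigma h
  prod _ _ _ _ h := kClass_pi h
  functionSpace Z E _ _ _ hZ hE := by
    -- The Lindelöf property makes the `cp`-network of `Z` countable even when `Z` is represented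
    -- over a target that is not second-countable.
    obtain ⟨_, 𝒟, hD, hexp, -⟩ := hZ.exists_isCpNetwork
    have hk := hD.hasCountableKNetwork hexp.isSigmaLocallyFinite.countable
    obtain ⟨X, Y, _, _, φ, _, h2, h3, h4, hφ⟩ := hE
    exact ⟨Z × X, Y, _, _, _, inferInstance, hk.prod h2, h3, h4, isKRep_continuousMap hφ⟩

theorem mainTheorem8 :
    (∀ (Z : Type u) [TopologicalSpace Z],
      separableMetrizableClass.{u}.ckClosure Z → IsFrakP0Space Z) ∧
    (∀ (Z : Type u) [TopologicalSpace Z],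
      metrizableClass.{u}.ckClosure Z → ParacompactSpace Z ∧ IsFrakPSpace Z) := by
  refine ⟨fun Z _ hZ => ?_, fun Z _ hZ => ?_⟩
  · obtain ⟨h1, 𝒟, hD, -, hc⟩ := (hZ _ (isCkStable_kClass True) fun X _ hX => by
      obtain ⟨_, _⟩ := hX
      let _ := TopologicalSpace.metrizableSpaceMetric X
      exact kClass_of_metrizable X fun _ =>
        UniformSpace.secondCountable_of_separable X).exists_isCpNetwork
    exact ⟨h1, 𝒟, hc trivial, hD⟩
  · obtain ⟨h1, 𝒟, hD, hexp, -⟩ := (hZ _ (isCkStable_kClass False) fun X _ hX => by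
      have : TopologicalSpace.MetrizableSpace X := hX
      exact kClass_of_metrizable X False.elim).exists_isCpNetwork
    exact ⟨hexp.paracompactSpace hD, h1, 𝒟, hexp.isSigmaLocallyFinite, hD⟩
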